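/- Let $k:\mathcal X\times\mathcal X\to\mathbb R$ be a positive definite kernel on a set $\mathcal X$ (for all finite families of points the matrix of pairwise evaluations is symmetric positive semidefinite), let $x_1,\dots,x_n\in\mathcal X$, let $K=(k(x_i,x_j))_{i,j}\in\mathbb R^{n\times n}$, and let $R\in\mathbb R^{n\times n}$ be an upper triangular matrix with $R^TR=K$. Put $\Psi_i=R_{:,i}\otimes I_d\in\mathbb R^{nd\times d}$, where $R_{:,i}$ is the $i$-th column of $R$. Write $\mathbb S(\mathbb R^m)$ for the symmetric and $\mathbb S(\mathbb R^m)_+$ for the symmetric positive semidefinite real $m\times m$ matrices, $\langle A,B\rangle=\operatorname{tr}(A^TB)$, $\|A\|_F^2=\langle A,A\rangle$, and $[M]_-=U\max(0,-\Sigma)U^T$ for the negative part of a symmetric matrix $M=U\Sigma U^T$ ($U$ orthogonal, $\Sigma$ diagonal). Let $L:\mathbb S(\mathbb R^d)^n\to\mathbb R\cup\{+\infty\}$ be convex, lower semicontinuous and bounded from below, with effective domain $\operatorname{dom}L=\{X: L(X)<+\infty\}$ and Fenchel conjugate $$L^*(Y)=\sup_{X\in\mathbb S(\mathbb R^d)^n}\Big\{\sum_{i=1}^n\langle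 Y^{(i)},X^{(i)}\rangle-L(X)\Big\}.$$ For $\lambda_1,\lambda_2\ge 0$ consider the problem $$(P)\qquad \inf_{B\in\mathbb S(\mathbb R^{nd})_+}\; L\big(\Psi_1^TB\Psi_1,\dots,\Psi_n^TB\Psi_n\big)+\lambda_1\operatorname{tr}B+\frac{\lambda_2}{2}\|B\|_F^2,$$ and assume that it has a feasible point, i.e. $(\Psi_i^TB\Psi_i)_{i}\in\operatorname{dom}L$ for some $B\in\mathbb S(\mathbb R^{nd})_+$. (i) If $\lambda_2>0$ and $\lambda_1\ge0$, then the value of $(P)$ equals $$(D)\qquad \sup_{\Gamma\in\mathbb S(\mathbb R^d)^n}\; -L^*(\Gamma)-\frac1{2\lambda_2}\Big\|\Big[\sum_{i=1}^n\Psi_i\Gamma^{(i)}\Psi_i^T+\lambda_1I_{nd}\Big]_-\Big\|_F^2 .$$ The supremum in $(D)$ is attained if $(\Psi_i^TB\Psi_i)_{i}$ lies in the interior of $\operatorname{dom}L$ for some $B\in\mathbb S(\mathbb R^{nd})_+$; in particular it is attained whenever $L$ is finite everywhere. Further, if $\Gamma_\star$ is an optimal solution of $(D)$, then $$B^\star=\frac1{\lambda_2}\Big[\sum_{i=1}^n\Psi_i\Gamma_\star^{(i)}\Psi_i^T+\lambda_1I_{nd}\Big]_-$$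 is positive semidefinite and is an optimal solution of $(P)$. (ii) If $\lambda_2=0$ and $\lambda_1>0$, then the value of $(P)$ equals $$\sup_{\Gamma\in\mathbb S(\mathbb R^d)^n}\; -L^*(\Gamma)\quad\text{subject to}\quad \sum_{i=1}^n\Psi_i\Gamma^{(i)}\Psi_i^T+\lambda_1I_{nd}\succeq0 .$$ -/

import Mathlib

open scoped Matrix

noncomputable section

namespace PSDLearning

/-- The real vector space of symmetric matrices with index type `m`. -/
def symMat (m : Type) : Submodule ℝ (Matrix m m ℝ) where
  carrier := {A | A.IsSymm}
  add_mem' hA hB := Matrix.IsSymm.add hA hB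
  zero_mem' := Matrix.isSymm_zero
  smul_mem' c _ hA := Matrix.IsSymm.smul hA c

/-- The Frobenius inner product `tr (Aᵀ B)`. -/
def frobInner {m : Type} [Fintype m] (A B : Matrix m m ℝ) : ℝ := (Aᵀ * B).trace

/-- The squared Frobenius norm `tr (Aᵀ A)`. -/
def frobSq {m : Type} [Fintype m] (A : Matrix m m ℝ) : ℝ := frobInner A A

/-- The cone of positive semidefinite matrices. -/
def psdCone (m : Type) : Set (symMat m) := {B | B.1.PosSemidef}

/-- The negative part `U max(0, -Σ) Uᵀ` of a symmetric matrix `U Σ Uᵀ`, given by the functional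
calculus with the function `t ↦ max (-t) 0`. -/
def negPart {m : Type} [Fintype m] [DecidableEq m] (M : symMat m) : symMat m :=
  ⟨(M.1)⁻, by
    have h : IsSelfAdjoint ((M.1)⁻) := by
      rw [CFC.negPart_def]
      exact cfcₙ_predicate _ _
    change ((M.1)⁻)ᵀ = (M.1)⁻
    rw [← Matrix.conjTranspose_eq_transpose_of_trivial]
    exact h⟩

/-- `R` is an upper triangular Cholesky factor of `K`. -/
def IsUpperCholesky {n : ℕ} (R K : Matrix (Fin n) (Fin n) ℝ) : Prop :=
  R.BlockTriangular id ∧ Rᵀ * R = K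

/-- The kernel matrix `K i j = k (x i) (x j)`. -/
def kernelMatrix {X : Type*} {n : ℕ} (k : X → X → ℝ) (x : Fin n → X) :
    Matrix (Fin n) (Fin n) ℝ :=
  Matrix.of fun i j => k (x i) (x j)

/-- The finite-dimensional features `Ψ ℓ = R_{:, ℓ} ⊗ I_d`, matrices of size `nd × d`. -/
def features {n : ℕ} (d : ℕ) (R : Matrix (Fin n) (Fin n) ℝ) (ℓ : Fin n) :
    Matrix (Fin n × Fin d) (Fin d) ℝ :=
  Matrix.of fun p b => R p.1 ℓ * (1 : Matrix (Fin d) (Fin d) ℝ) p.2 b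

variable {n d : ℕ}

/-- The evaluations `F_B(x_i) = Ψ_iᵀ B Ψ_i`, `i = 1, …, n`. -/
def evals (Ψ : Fin n → Matrix (Fin n × Fin d) (Fin d) ℝ) (B : symMat (Fin n × Fin d)) :
    Fin n → symMat (Fin d) :=
  fun i => ⟨(Ψ i)ᵀ * B.1 * Ψ i, by
    have hB : (B.1)ᵀ = B.1 := B.2
    change ((Ψ i)ᵀ * B.1 * Ψ i)ᵀ = (Ψ i)ᵀ * B.1 * Ψ i
    simp [Matrix.transpose_mul, hB, Matrix.mul_assoc]⟩

/-- The regularizer `λ₁ tr B + (λ₂ / 2) ‖B‖_F²`. -/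
def regularizer (lam₁ lam₂ : ℝ) (B : symMat (Fin n × Fin d)) : ℝ :=
  lam₁ * B.1.trace + lam₂ / 2 * frobSq B.1

/-- The objective `L (F_B(x_1), …, F_B(x_n)) + Ω(B)` of the primal problem. -/
def primalObj (L : (Fin n → symMat (Fin d)) → EReal)
    (Ψ : Fin n → Matrix (Fin n × Fin d) (Fin d) ℝ) (lam₁ lam₂ : ℝ)
    (B : symMat (Fin n × Fin d)) : EReal :=
  L (evals Ψ B) + (regularizer lam₁ lam₂ B : EReal)

/-- The effective domain of an extended-real-valued function. -/
def effDom {E : Type*} (L : E → EReal) : Set E := {X | L X < ⊤}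

/-- Convexity of an extended-real-valued function: its epigraph is convex. -/
def IsConvexFun {E : Type*} [AddCommGroup E] [Module ℝ E] (L : E → EReal) : Prop :=
  Convex ℝ {p : E × ℝ | L p.1 ≤ (p.2 : EReal)}

/-- The Fenchel conjugate `L*(Y) = sup_X (∑ i, ⟨Y i, X i⟩ - L X)`. -/
def fenchelConj (L : (Fin n → symMat (Fin d)) → EReal) (Y : Fin n → symMat (Fin d)) : EReal :=
  ⨆ X : Fin n → symMat (Fin d), ((∑ i, frobInner (Y i).1 (X i).1 : ℝ) : EReal) - L X

/-- The matrix `∑ i, Ψ_i Γ_i Ψ_iᵀ + λ₁ I`. -/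
def dualMat (Ψ : Fin n → Matrix (Fin n × Fin d) (Fin d) ℝ) (lam₁ : ℝ)
    (Γ : Fin n → symMat (Fin d)) : symMat (Fin n × Fin d) :=
  ⟨∑ i, Ψ i * (Γ i).1 * (Ψ i)ᵀ + lam₁ • (1 : Matrix (Fin n × Fin d) (Fin n × Fin d) ℝ), by
    have hΓ : ∀ i, ((Γ i).1)ᵀ = (Γ i).1 := fun i => (Γ i).2
    change (_ : Matrix _ _ ℝ)ᵀ = _
    simp [Matrix.transpose_add, Matrix.transpose_sum, Matrix.transpose_mul, hΓ,
      Matrix.mul_assoc]⟩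

/-- The dual objective `-L*(Γ) - (1 / (2 λ₂)) ‖[∑ i, Ψ_i Γ_i Ψ_iᵀ + λ₁ I]_-‖_F²`. -/
def dualObj (L : (Fin n → symMat (Fin d)) → EReal)
    (Ψ : Fin n → Matrix (Fin n × Fin d) (Fin d) ℝ) (lam₁ lam₂ : ℝ)
    (Γ : Fin n → symMat (Fin d)) : EReal :=
  -fenchelConj L Γ - ((1 / (2 * lam₂) * frobSq (negPart (dualMat Ψ lam₁ Γ)).1 : ℝ) : EReal)

end PSDLearning

end

/-! This is perturbation duality. Let `v(Z)` be the infimum over the cone of `L (A B + Z) + G B`,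
with `A` the evaluation map and `G` the regularizer. The epigraph of `v` is convex, and it is closed
because `L` is bounded below and `G` has bounded sublevel sets on the cone. Hence every `r < v(0)`
is strictly separated from it, and feasibility forbids a vertical hyperplane, so there is a
multiplier certifying `r`: no gap, without any qualification. If some `A B` is interior to the
domain, the epigraph has interior and can be supported at `(0, v(0))` itself, which gives
attainment. `fenchel_duality` packages this.

With the multiplier `-⟨Γ, ·⟩`, minimizing the Lagrangian over `X` yields `-L*(Γ)`. Over `B` it
leaves `⟨M, B⟩ + λ₂/2 ‖B‖²` with `M = dualMat Ψ λ₁ Γ`. The Moreau decomposition of `M` solves this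
for `λ₂ > 0`; for `λ₂ = 0` the infimum is `0` or `-∞` according to whether `M` is positive
semidefinite. The quadratic slack in `le_frobInner_add_frobSq` identifies the primal solution. -/

noncomputable section

namespace PSDLearning

/-! ### Abstract Fenchel duality by perturbation -/

section Duality

open Filter Topology Set

variable {E F : Type*} [NormedAddCommGroup E] [NormedSpace ℝ E]
  [NormedAddCommGroup F] [NormedSpace ℝ F]

/-- The epigraph of the value function `Z ↦ inf_{B ∈ K} L (A B + Z) + G B`. -/
def valueEpigraph (L : E → EReal) (A : F →L[ℝ] E) (K : Set F) (G : F → ℝ) : Set (E × ℝ) :=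
  {q | ∃ B ∈ K, L (A B + q.1) ≤ ((q.2 - G B : ℝ) : EReal)}

/-- `r` is a lower bound of the Lagrangian with multiplier `φ`. -/
def IsDualCertificate (L : E → EReal) (A : F →L[ℝ] E) (K : Set F) (G : F → ℝ)
    (φ : E →L[ℝ] ℝ) (r : ℝ) : Prop :=
  ∀ B ∈ K, ∀ X, ∀ s : ℝ, L X ≤ (s : EReal) → r ≤ s + φ X - φ (A B) + G B

variable {L : E → EReal} {A : F →L[ℝ] E} {K : Set F} {G : F → ℝ}

lemma valueEpigraph_mono {Z : E} {r s : ℝ} (h : (Z, r) ∈ valueEpigraph L A K G) (hrs : r ≤ s) :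
    (Z, s) ∈ valueEpigraph L A K G := by
  obtain ⟨B, hB, hL⟩ := h
  exact ⟨B, hB, hL.trans (by exact_mod_cast sub_le_sub_right hrs _)⟩

lemma convex_valueEpigraph (hL : IsConvexFun L) (hG : ConvexOn ℝ K G) :
    Convex ℝ (valueEpigraph L A K G) := by
  rintro ⟨Z₁, r₁⟩ ⟨B₁, hB₁, h₁⟩ ⟨Z₂, r₂⟩ ⟨B₂, hB₂, h₂⟩ a b ha hb hab
  refine ⟨a • B₁ + b • B₂, hG.1 hB₁ hB₂ ha hb hab, ?_⟩
  have h := hL (x := (A B₁ + Z₁, r₁ - G B₁)) h₁ (y := (A B₂ + Z₂, r₂ - G B₂)) h₂ ha hb hab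
  have hg := hG.2 hB₁ hB₂ ha hb hab
  simp only [mem_ofPred_eq, Prod.smul_mk, Prod.mk_add_mk, smul_eq_mul] at h hg ⊢
  have e : A (a • B₁ + b • B₂) + (a • Z₁ + b • Z₂) = a • (A B₁ + Z₁) + b • (A B₂ + Z₂) := by
    simp only [map_add, map_smul, smul_add]; abel
  rw [e]
  refine h.trans ?_
  rw [EReal.coe_le_coe_iff]
  linarith

lemma isClosed_epigraph_real {E : Type*} [TopologicalSpace E] {L : E → EReal}
    (hL : LowerSemicontinuous L) :
    IsClosed {p : E × ℝ | L p.1 ≤ (p.2 : EReal)} :=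
  hL.isClosed_epigraph.preimage
    (continuous_fst.prodMk (continuous_coe_real_ereal.comp continuous_snd))

/-- The lower bound on `L` keeps the witnesses `B k` of a convergent sequence in one sublevel set of
`G`, so a subsequence converges; closedness of the epigraph of `L` does the rest. -/
lemma isClosed_valueEpigraph [ProperSpace F] (hL : LowerSemicontinuous L) {c : ℝ}
    (hc : ∀ X, (c : EReal) ≤ L X) (hK : IsClosed K) (hG : Continuous G)
    (hbd : ∀ ρ, Bornology.IsBounded {B ∈ K | G B ≤ ρ}) :
    IsClosed (valueEpigraph L A K G) := by
  refine IsSeqClosed.isClosed fun q q₀ hq hlim => ?_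
  choose B hB hLB using hq
  have hsnd : Tendsto (fun k => (q k).2) atTop (𝓝 q₀.2) := (continuous_snd.tendsto q₀).comp hlim
  have hfst : Tendsto (fun k => (q k).1) atTop (𝓝 q₀.1) := (continuous_fst.tendsto q₀).comp hlim
  obtain ⟨ρ, hρ⟩ := hsnd.bddAbove_range
  have hmem : ∀ k, B k ∈ {B ∈ K | G B ≤ ρ - c} := fun k => by
    have h₁ : c ≤ (q k).2 - G (B k) := by exact_mod_cast (hc _).trans (hLB k)
    have h₂ : (q k).2 ≤ ρ := hρ ⟨k, rfl⟩
    exact ⟨hB k, by linarith⟩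
  obtain ⟨B₀, -, ψ, hψ, hB₀⟩ := tendsto_subseq_of_bounded (hbd (ρ - c)) hmem
  refine ⟨B₀, hK.mem_of_tendsto hB₀ (Eventually.of_forall fun k => hB _), ?_⟩
  have hT : Tendsto (fun k => (A (B (ψ k)) + (q (ψ k)).1, (q (ψ k)).2 - G (B (ψ k)))) atTop
      (𝓝 (A B₀ + q₀.1, q₀.2 - G B₀)) :=
    (((A.continuous.tendsto _).comp hB₀).add (hfst.comp hψ.tendsto_atTop)).prodMk_nhds
      ((hsnd.comp hψ.tendsto_atTop).sub ((hG.tendsto _).comp hB₀))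
  exact (isClosed_epigraph_real hL).mem_of_tendsto hT (Eventually.of_forall fun k => hLB _)

/-- A functional separating `(0, r)` from the epigraph of the value function, and not vertical,
yields a dual certificate. -/
lemma exists_isDualCertificate_of_separating {r u t : ℝ} (f : StrongDual ℝ (E × ℝ))
    (hf : ∀ q ∈ valueEpigraph L A K G, f (0, r) ≤ f q)
    (hu : (0, u) ∈ valueEpigraph L A K G) (hut : u ≤ t) (hpos : f (0, r) < f (0, t)) :
    ∃ φ : E →L[ℝ] ℝ, IsDualCertificate L A K G φ r := by
  have hdec : ∀ Z s, f (Z, s) = f (Z, 0) + s * f (0, 1) := fun Z s => by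
    rw [← smul_eq_mul, ← map_smul, ← map_add]; simp
  set a := f (0, 1)
  have h0 : ∀ s : ℝ, f (0, s) = s * a := fun s => by
    rw [hdec 0 s]; rw [show ((0 : E), (0 : ℝ)) = 0 from rfl, map_zero, zero_add]
  -- The epigraph is upward closed, so the slope `a` is nonnegative: test a height above both `r`
  -- and `t`. `hpos` excludes `a = 0`.
  have ha : 0 < a := by
    rw [h0, h0] at hpos
    have hr : r < max t r + 1 := by have := le_max_right t r; linarith
    have h1 := hf _ (valueEpigraph_mono hu (hut.trans ((le_max_left t r).trans
      (by linarith : max t r ≤ max t r + 1))))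
    rw [h0, h0] at h1
    have h2 : 0 ≤ (max t r + 1 - r) * a := by linarith
    have h3 : 0 ≤ a := nonneg_of_mul_nonneg_right h2 (by linarith)
    rcases h3.eq_or_lt with h | h
    · rw [← h] at hpos; simp at hpos
    · exact h
  refine ⟨a⁻¹ • f.comp (ContinuousLinearMap.inl ℝ E ℝ), fun B hB X s hs => ?_⟩
  -- The perturbation `X - A B` decouples `X` from `B`.
  have hq : (X - A B, s + G B) ∈ valueEpigraph L A K G :=
    ⟨B, hB, by simpa using hs⟩
  have h := hf _ hq
  rw [h0, hdec, show (X - A B, (0 : ℝ)) = (X, 0) - (A B, 0) by simp, map_sub] at h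
  simp only [smul_apply, ContinuousLinearMap.comp_apply,
    ContinuousLinearMap.inl_apply, smul_eq_mul]
  have h' : r ≤ a⁻¹ * (f (X, 0) - f (A B, 0) + (s + G B) * a) := by
    rw [le_inv_mul_iff₀ ha]; linarith
  have e : a⁻¹ * (f (X, 0) - f (A B, 0) + (s + G B) * a)
      = s + a⁻¹ * f (X, 0) - a⁻¹ * f (A B, 0) + G B := by
    field_simp; ring
  linarith

/-- Strict separation already makes the hyperplane non-vertical, since `(0, u)` and `(0, r)` lie
over the same point. -/
lemma exists_isDualCertificate_of_notMem [ProperSpace F] (hconv : IsConvexFun L)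
    (hL : LowerSemicontinuous L) {c : ℝ} (hc : ∀ X, (c : EReal) ≤ L X) (hK : IsClosed K)
    (hG : Continuous G) (hGc : ConvexOn ℝ K G) (hbd : ∀ ρ, Bornology.IsBounded {B ∈ K | G B ≤ ρ})
    {r u : ℝ} (hu : (0, u) ∈ valueEpigraph L A K G) (hr : (0, r) ∉ valueEpigraph L A K G) :
    ∃ φ : E →L[ℝ] ℝ, IsDualCertificate L A K G φ r := by
  obtain ⟨f, w, hw, hf⟩ := geometric_hahn_banach_point_closed
    (convex_valueEpigraph (A := A) hconv hGc) (isClosed_valueEpigraph hL hc hK hG hbd) hr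
  exact exists_isDualCertificate_of_separating f (fun q hq => (hw.trans (hf q hq)).le) hu le_rfl
    (hw.trans (hf _ hu))

/-- A convex function bounded from below is locally bounded above in the interior of its
effective domain. -/
lemma exists_eventually_le_of_mem_interior [FiniteDimensional ℝ E] (hconv : IsConvexFun L) {c : ℝ}
    (hc : ∀ X, (c : EReal) ≤ L X) {X₀ : E} (hX₀ : X₀ ∈ interior (effDom L)) :
    ∃ M : ℝ, ∀ᶠ X in 𝓝 X₀, L X ≤ (M : EReal) := by
  have hreal : ∀ X ∈ effDom L, ((L X).toReal : EReal) = L X := fun X hX =>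
    EReal.coe_toReal (ne_of_lt hX) (ne_of_gt ((EReal.bot_lt_coe c).trans_le (hc X)))
  have hcv : ConvexOn ℝ (effDom L) (fun X => (L X).toReal) := by
    have key : ∀ X ∈ effDom L, ∀ Y ∈ effDom L, ∀ a b : ℝ, 0 ≤ a → 0 ≤ b → a + b = 1 →
        L (a • X + b • Y) ≤ ((a * (L X).toReal + b * (L Y).toReal : ℝ) : EReal) :=
      fun X hX Y hY a b ha hb hab => hconv (x := (X, (L X).toReal)) (hreal X hX).ge
        (y := (Y, (L Y).toReal)) (hreal Y hY).ge ha hb hab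
    have hdom : Convex ℝ (effDom L) := fun X hX Y hY a b ha hb hab =>
      (key X hX Y hY a b ha hb hab).trans_lt (EReal.coe_lt_top _)
    refine ⟨hdom, fun X hX Y hY a b ha hb hab => ?_⟩
    have h := key X hX Y hY a b ha hb hab
    rw [← hreal _ (hdom hX hY ha hb hab)] at h
    exact_mod_cast h
  -- In finite dimension a real convex function is continuous in the interior of its domain.
  have hcont := hcv.continuousOn_interior.continuousAt (isOpen_interior.mem_nhds hX₀)
  refine ⟨(L X₀).toReal + 1, ?_⟩
  filter_upwards [hcont.eventually_lt_const (lt_add_one _), isOpen_interior.mem_nhds hX₀]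
    with X hX hXd
  rw [← hreal X (interior_subset hXd)]
  exact_mod_cast hX.le

lemma exists_isDualCertificate_of_interior [FiniteDimensional ℝ E] (hconv : IsConvexFun L) {c : ℝ}
    (hc : ∀ X, (c : EReal) ≤ L X) (hGc : ConvexOn ℝ K G) {v : ℝ}
    (hv : ∀ r < v, (0, r) ∉ valueEpigraph L A K G)
    (hint : ∃ B ∈ K, A B ∈ interior (effDom L)) :
    ∃ φ : E →L[ℝ] ℝ, IsDualCertificate L A K G φ v := by
  obtain ⟨B, hB, hAB⟩ := hint
  obtain ⟨M, hM⟩ := exists_eventually_le_of_mem_interior hconv hc hAB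
  set C := valueEpigraph L A K G with hC
  have hnhds : C ∈ 𝓝 ((0 : E), M + G B + 1) := by
    rw [nhds_prod_eq]
    have h₁ : ∀ᶠ Z in 𝓝 (0 : E), L (A B + Z) ≤ (M : EReal) := by
      have ht : Tendsto (fun Z => A B + Z) (𝓝 (0 : E)) (𝓝 (A B)) :=
        Continuous.tendsto' (by fun_prop) _ _ (add_zero _)
      exact ht.eventually hM
    have h₂ : ∀ᶠ s in 𝓝 (M + G B + 1), M + G B < s := lt_mem_nhds (lt_add_one _)
    filter_upwards [h₁.prod_mk h₂] with q hq
    exact ⟨B, hB, hq.1.trans (by rw [EReal.coe_le_coe_iff]; linarith [hq.2])⟩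
  have hmem : ((0 : E), M + G B + 1) ∈ interior C := mem_interior_iff_mem_nhds.2 hnhds
  have hconvC : Convex ℝ C := convex_valueEpigraph hconv hGc
  -- An interior point would have epigraph points directly below it, at heights less than `v`.
  have hvC : ((0 : E), v) ∉ interior C := fun h => by
    have ht : Tendsto (fun s : ℝ => ((0 : E), s)) (𝓝 v) (𝓝 (0, v)) :=
      (Continuous.prodMk_right (0 : E)).tendsto v
    have hev : ∀ᶠ s in 𝓝 v, ((0 : E), s) ∈ C := ht.eventually (mem_interior_iff_mem_nhds.1 h)
    obtain ⟨s, hs, hsv⟩ := (hev.filter_mono nhdsWithin_le_nhds |>.and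
      (self_mem_nhdsWithin (s := Iio v))).exists
    exact hv s hsv hs
  obtain ⟨f, hf⟩ := geometric_hahn_banach_point_open hconvC.interior isOpen_interior hvC
  refine exists_isDualCertificate_of_separating f (fun q hq => ?_) (interior_subset hmem) le_rfl
    (hf _ hmem)
  -- The separation concerns the interior only, but a convex set with interior lies in the closure
  -- of its interior.
  have hcl : q ∈ closure (interior C) := by
    rw [hconvC.closure_interior_eq_closure_of_nonempty_interior ⟨_, hmem⟩]
    exact subset_closure hq
  exact closure_minimal (fun p hp => (hf p hp).le)
    (isClosed_le continuous_const f.continuous) hcl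

lemma add_coe_le_coe_iff {x : EReal} {g r : ℝ} :
    x + (g : EReal) ≤ (r : EReal) ↔ x ≤ ((r - g : ℝ) : EReal) := by
  induction x with
  | bot => simp
  | top => simp [-EReal.coe_sub]
  | coe x => norm_cast; exact le_sub_iff_add_le.symm

lemma mem_valueEpigraph_zero {r : ℝ} :
    (0, r) ∈ valueEpigraph L A K G ↔ ∃ B ∈ K, L (A B) + (G B : EReal) ≤ (r : EReal) := by
  simp only [valueEpigraph, mem_ofPred_eq, add_zero, add_coe_le_coe_iff]

/-- The primal value is finite and the primal problem has a solution. -/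
lemma exists_primal_solution [ProperSpace F] (hL : LowerSemicontinuous L) {c : ℝ}
    (hc : ∀ X, (c : EReal) ≤ L X) (hK : IsClosed K) (hG : Continuous G) (hG0 : ∀ B ∈ K, 0 ≤ G B)
    (hbd : ∀ ρ, Bornology.IsBounded {B ∈ K | G B ≤ ρ}) (hfeas : ∃ B ∈ K, A B ∈ effDom L) :
    ∃ v : ℝ, (⨅ B ∈ K, L (A B) + (G B : EReal)) = v ∧
      ∃ B ∈ K, L (A B) + (G B : EReal) ≤ v := by
  set V := ⨅ B ∈ K, L (A B) + (G B : EReal) with hV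
  have hlow : (c : EReal) ≤ V := le_iInf₂ fun B hB => by
    have h := add_le_add (hc (A B)) (EReal.coe_nonneg.2 (hG0 B hB))
    simpa using h
  have htop : V < ⊤ := by
    obtain ⟨B, hB, hAB⟩ := hfeas
    exact (iInf₂_le B hB).trans_lt (EReal.add_lt_top (ne_of_lt hAB) (EReal.coe_ne_top _))
  have hVr : (V.toReal : EReal) = V :=
    EReal.coe_toReal htop.ne ((EReal.bot_lt_coe c).trans_le hlow).ne'
  refine ⟨V.toReal, hVr.symm, ?_⟩
  rw [← mem_valueEpigraph_zero]
  have hcl := isClosed_valueEpigraph (A := A) hL hc hK hG hbd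
  have ht : Tendsto (fun s : ℝ => ((0 : E), s)) (𝓝[>] V.toReal) (𝓝 (0, V.toReal)) :=
    ((Continuous.prodMk_right (0 : E)).tendsto _).mono_left nhdsWithin_le_nhds
  refine hcl.mem_of_tendsto ht ?_
  filter_upwards [self_mem_nhdsWithin] with s hs
  have hs' : V < (s : EReal) := by rw [← hVr]; exact_mod_cast hs
  rw [hV] at hs'
  simp only [iInf_lt_iff] at hs'
  obtain ⟨B, hB, h⟩ := hs'
  exact mem_valueEpigraph_zero.2 ⟨B, hB, h.le⟩

/-- Fenchel duality: if `D` is the dual objective, parametrised so that every multiplier occurs,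
the primal and dual values agree, and the dual value is attained under an interiority condition. -/
theorem fenchel_duality [ProperSpace F] [FiniteDimensional ℝ E] {ι : Type*} (hconv : IsConvexFun L)
    (hL : LowerSemicontinuous L) {c : ℝ} (hc : ∀ X, (c : EReal) ≤ L X) (hK : IsClosed K)
    (hG : Continuous G) (hGc : ConvexOn ℝ K G) (hG0 : ∀ B ∈ K, 0 ≤ G B)
    (hbd : ∀ ρ, Bornology.IsBounded {B ∈ K | G B ≤ ρ}) (hfeas : ∃ B ∈ K, A B ∈ effDom L)
    (D : ι → EReal) (π : ι → E →L[ℝ] ℝ) (hπ : Function.Surjective π)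
    (hD : ∀ i (r : ℝ), (r : EReal) ≤ D i ↔ IsDualCertificate L A K G (π i) r) :
    (⨅ B ∈ K, L (A B) + (G B : EReal)) = ⨆ i, D i ∧
    ((∃ B ∈ K, A B ∈ interior (effDom L)) → ∃ i, IsMaxOn D univ i) := by
  obtain ⟨v, hv, B₀, hB₀, hB₀v⟩ := exists_primal_solution hL hc hK hG hG0 hbd hfeas
  have hu : (0, v) ∈ valueEpigraph L A K G := mem_valueEpigraph_zero.2 ⟨B₀, hB₀, hB₀v⟩
  have hlt : ∀ r < v, (0, r) ∉ valueEpigraph L A K G := fun r hr h => by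
    obtain ⟨B, hB, hBr⟩ := mem_valueEpigraph_zero.1 h
    have : (v : EReal) ≤ r := hv ▸ (iInf₂_le B hB).trans hBr
    exact hr.not_ge (by exact_mod_cast this)
  have hweak : ∀ i, D i ≤ v := fun i => EReal.ge_of_forall_gt_iff_ge.1 fun r hr => by
    -- Testing at `X = A B₀` cancels the multiplier terms: weak duality.
    have h := (hD i r).1 hr.le B₀ hB₀ (A B₀) (v - G B₀) (add_coe_le_coe_iff.1 hB₀v)
    exact_mod_cast (by linarith : r ≤ v)
  rw [hv]
  refine ⟨le_antisymm ?_ (iSup_le hweak), fun hint => ?_⟩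
  · refine EReal.ge_of_forall_gt_iff_ge.1 fun r hr => ?_
    obtain ⟨φ, hφ⟩ := exists_isDualCertificate_of_notMem hconv hL hc hK hG hGc hbd hu
      (hlt r (by exact_mod_cast hr))
    obtain ⟨i, rfl⟩ := hπ φ
    exact ((hD i r).2 hφ).trans (le_iSup D i)
  · obtain ⟨φ, hφ⟩ := exists_isDualCertificate_of_interior hconv hc hGc hlt hint
    obtain ⟨i, rfl⟩ := hπ φ
    exact ⟨i, fun j _ => (hweak j).trans ((hD i v).2 hφ)⟩

end Duality

/-! ### Frobenius geometry of the positive semidefinite cone -/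

section Frobenius

variable {m : Type} [Fintype m]

lemma frobInner_eq_sum (A B : Matrix m m ℝ) : frobInner A B = ∑ j, ∑ i, A i j * B i j := by
  simp [frobInner, Matrix.trace, Matrix.mul_apply]

lemma frobInner_comm (A B : Matrix m m ℝ) : frobInner A B = frobInner B A := by
  simp only [frobInner_eq_sum, mul_comm]

lemma frobInner_add_left (A B C : Matrix m m ℝ) :
    frobInner (A + B) C = frobInner A C + frobInner B C := by
  simp [frobInner, Matrix.add_mul]

lemma frobInner_add_right (A B C : Matrix m m ℝ) :
    frobInner A (B + C) = frobInner A B + frobInner A C := by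
  simp [frobInner, Matrix.mul_add]

lemma frobInner_sub_left (A B C : Matrix m m ℝ) :
    frobInner (A - B) C = frobInner A C - frobInner B C := by
  simp [frobInner, Matrix.sub_mul]

lemma frobInner_sub_right (A B C : Matrix m m ℝ) :
    frobInner A (B - C) = frobInner A B - frobInner A C := by
  simp [frobInner, Matrix.mul_sub]

lemma frobInner_smul_left (a : ℝ) (A B : Matrix m m ℝ) :
    frobInner (a • A) B = a * frobInner A B := by
  simp [frobInner]

lemma frobInner_smul_right (a : ℝ) (A B : Matrix m m ℝ) :
    frobInner A (a • B) = a * frobInner A B := by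
  simp [frobInner]

lemma sq_apply_le_frobSq (A : Matrix m m ℝ) (i j : m) : A i j ^ 2 ≤ frobSq A := by
  rw [frobSq, frobInner_eq_sum]
  calc A i j ^ 2 = A i j * A i j := sq _
    _ ≤ ∑ i, A i j * A i j :=
      Finset.single_le_sum (f := fun i => A i j * A i j) (fun i _ => mul_self_nonneg _)
        (Finset.mem_univ i)
    _ ≤ _ := Finset.single_le_sum (f := fun j => ∑ i, A i j * A i j)
        (fun j _ => Finset.sum_nonneg fun i _ => mul_self_nonneg _) (Finset.mem_univ j)

lemma frobSq_nonneg (A : Matrix m m ℝ) : 0 ≤ frobSq A := by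
  rw [frobSq, frobInner_eq_sum]
  exact Finset.sum_nonneg fun j _ => Finset.sum_nonneg fun i _ => mul_self_nonneg _

lemma eq_zero_of_frobSq_nonpos {A : Matrix m m ℝ} (h : frobSq A ≤ 0) : A = 0 := by
  ext i j
  exact pow_eq_zero_iff two_ne_zero |>.1 (le_antisymm ((sq_apply_le_frobSq A i j).trans h)
    (sq_nonneg _))

lemma continuous_frobSq : Continuous fun A : Matrix m m ℝ => frobSq A := by
  unfold frobSq frobInner
  fun_prop

lemma mem_psdCone_iff {B : symMat m} : B ∈ psdCone m ↔ ∀ x : m → ℝ, 0 ≤ x ⬝ᵥ (B.1 *ᵥ x) := by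
  refine ⟨fun h x => by simpa using Matrix.PosSemidef.dotProduct_mulVec_nonneg h x, fun h => ?_⟩
  refine Matrix.PosSemidef.of_dotProduct_mulVec_nonneg ?_ fun x => by simpa using h x
  rw [Matrix.IsHermitian, Matrix.conjTranspose_eq_transpose_of_trivial]
  exact B.2

lemma isClosed_psdCone : IsClosed (psdCone m) := by
  have e : psdCone m = {B | ∀ x : m → ℝ, 0 ≤ x ⬝ᵥ (B.1 *ᵥ x)} := by
    ext B; exact mem_psdCone_iff
  rw [e]
  simp only [Set.ofPred_forall]
  refine isClosed_iInter fun x => isClosed_le continuous_const ?_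
  fun_prop

lemma convex_psdCone {m : Type} : Convex ℝ (psdCone m) := by
  intro A hA B hB a b ha hb _
  exact (Matrix.PosSemidef.smul hA ha).add (Matrix.PosSemidef.smul hB hb)

/-- One half of self-duality of the cone: `⟨M, x xᵀ⟩ = xᵀ M x`. -/
lemma exists_frobInner_neg {M : symMat m} (hM : M ∉ psdCone m) :
    ∃ B ∈ psdCone m, frobInner M.1 B.1 < 0 := by
  rw [mem_psdCone_iff] at hM
  push Not at hM
  obtain ⟨x, hx⟩ := hM
  have hp : (Matrix.vecMulVec x x).PosSemidef := by
    simpa using Matrix.posSemidef_vecMulVec_self_star x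
  refine ⟨⟨Matrix.vecMulVec x x, ?_⟩, hp, ?_⟩
  · change (Matrix.vecMulVec x x)ᵀ = _
    rw [← Matrix.conjTranspose_eq_transpose_of_trivial]; exact hp.1
  · refine lt_of_eq_of_lt ?_ hx
    have hs : (M.1)ᵀ = M.1 := M.2
    rw [frobInner, hs, Matrix.mul_vecMulVec, Matrix.trace_vecMulVec, dotProduct_comm]

variable [DecidableEq m]

open scoped MatrixOrder in
lemma frobInner_nonneg {A B : Matrix m m ℝ} (hA : A.PosSemidef) (hB : B.PosSemidef) :
    0 ≤ frobInner A B := by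
  obtain ⟨C, rfl⟩ := CStarAlgebra.nonneg_iff_eq_star_mul_self.1 (Matrix.nonneg_iff_posSemidef.2 hA)
  rw [Matrix.star_eq_conjTranspose]
  have e : frobInner (Cᴴ * C) B = (C * B * Cᴴ).trace := by
    rw [frobInner, ← Matrix.conjTranspose_eq_transpose_of_trivial,
      (Matrix.isHermitian_conjTranspose_mul_self C).eq, Matrix.mul_assoc, Matrix.trace_mul_comm]
  rw [e]
  exact (hB.mul_mul_conjTranspose_same C).trace_nonneg

/-- The quadratic form at `e_i ± e_j` gives `2 |B i j| ≤ B i i + B j j`. -/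
lemma abs_apply_le_trace {B : Matrix m m ℝ} (hB : B.PosSemidef) (i j : m) :
    |B i j| ≤ B.trace := by
  have hd : ∀ k, B k k ≤ B.trace := fun k =>
    Finset.single_le_sum (f := fun k => B k k) (fun l _ => hB.diag_nonneg) (Finset.mem_univ k)
  have hs : B j i = B i j := by simpa using hB.1.apply i j
  have hq : ∀ t : ℝ, 0 ≤ B i i + 2 * t * B i j + t * t * B j j := fun t => by
    have h := hB.dotProduct_mulVec_nonneg (Pi.single i 1 + t • Pi.single j 1)
    simp [Matrix.mulVec_add, Matrix.mulVec_smul, add_dotProduct, hs] at h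
    linarith
  have h1 := hq 1
  have h2 := hq (-1)
  rw [abs_le]
  constructor <;> linarith [hd i, hd j]

open scoped MatrixOrder in
-- The Moreau decomposition of `M`; the optimization over `B` needs nothing else about the negative
-- part.
lemma exists_posPart (M : symMat m) : ∃ P : Matrix m m ℝ, P.PosSemidef ∧
    (negPart M).1.PosSemidef ∧ M.1 = P - (negPart M).1 ∧ frobInner P (negPart M).1 = 0 := by
  have hM : IsSelfAdjoint M.1 := by
    change (M.1)ᴴ = M.1
    rw [Matrix.conjTranspose_eq_transpose_of_trivial]
    exact M.2
  have hP : ((M.1)⁺).PosSemidef := Matrix.nonneg_iff_posSemidef.1 (CFC.posPart_nonneg _)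
  refine ⟨(M.1)⁺, hP, Matrix.nonneg_iff_posSemidef.1 (CFC.negPart_nonneg _),
    (CFC.posPart_sub_negPart _ hM).symm, ?_⟩
  have ht : ((M.1)⁺)ᵀ = (M.1)⁺ := by
    rw [← Matrix.conjTranspose_eq_transpose_of_trivial]; exact hP.1
  change (((M.1)⁺)ᵀ * (M.1)⁻).trace = 0
  rw [ht, CFC.posPart_mul_negPart, Matrix.trace_zero]

lemma smul_negPart_mem_psdCone (M : symMat m) {a : ℝ} (ha : 0 ≤ a) :
    a • negPart M ∈ psdCone m := by
  obtain ⟨-, -, hN, -⟩ := exists_posPart M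
  exact Matrix.PosSemidef.smul hN ha

/-- Completing the square: the quadratic `B ↦ ⟨M, B⟩ + μ / 2 ‖B‖²` on the cone of positive
semidefinite matrices exceeds its minimum by at least `μ / 2 ‖B - μ⁻¹ [M]₋‖²`. -/
lemma le_frobInner_add_frobSq (M : symMat m) {μ : ℝ} (hμ : 0 < μ) {B : symMat m}
    (hB : B ∈ psdCone m) :
    μ / 2 * frobSq (B.1 - μ⁻¹ • (negPart M).1) - 1 / (2 * μ) * frobSq (negPart M).1
      ≤ frobInner M.1 B.1 + μ / 2 * frobSq B.1 := by
  obtain ⟨P, hP, hN, hM, hPN⟩ := exists_posPart M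
  have h := frobInner_nonneg hP hB
  rw [hM]
  generalize (negPart M).1 = N at *
  have hNB := frobInner_comm B.1 N
  simp only [frobSq, frobInner_sub_left, frobInner_sub_right, frobInner_smul_left,
    frobInner_smul_right, hNB]
  -- Since `⟨P, B⟩ ≥ 0` can be dropped, only the square for `-N` has to be completed.
  have e : μ / 2 * (frobInner B.1 B.1 - μ⁻¹ * frobInner N B.1
      - (μ⁻¹ * frobInner N B.1 - μ⁻¹ * (μ⁻¹ * frobInner N N))) - 1 / (2 * μ) * frobInner N N
      = μ / 2 * frobInner B.1 B.1 - frobInner N B.1 := by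
    field_simp; ring
  linarith

/-- The preceding bound is tight here because `⟨P, N⟩ = 0`. -/
lemma frobInner_add_frobSq_negPart (M : symMat m) {μ : ℝ} (hμ : 0 < μ) :
    frobInner M.1 (μ⁻¹ • negPart M).1 + μ / 2 * frobSq (μ⁻¹ • negPart M).1
      = -(1 / (2 * μ) * frobSq (negPart M).1) := by
  obtain ⟨P, hP, hN, hM, hPN⟩ := exists_posPart M
  change frobInner M.1 (μ⁻¹ • (negPart M).1) + μ / 2 * frobSq (μ⁻¹ • (negPart M).1) = _
  rw [hM]
  generalize (negPart M).1 = N at *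
  simp only [frobSq, frobInner_sub_left, frobInner_smul_left, frobInner_smul_right, hPN]
  field_simp; ring

end Frobenius

/-! ### The learning problem as an instance of the duality theorem -/

section Problem

attribute [local instance] Matrix.normedAddCommGroup Matrix.normedSpace

variable {n d : ℕ} {Ψ : Fin n → Matrix (Fin n × Fin d) (Fin d) ℝ}

/-- The evaluations as a continuous linear map. -/
def evalsCLM (Ψ : Fin n → Matrix (Fin n × Fin d) (Fin d) ℝ) :
    symMat (Fin n × Fin d) →L[ℝ] (Fin n → symMat (Fin d)) :=
  LinearMap.toContinuousLinearMap
    { toFun := evals Ψ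
      map_add' := fun A B => by
        ext i a b; simp [evals, Matrix.mul_add, Matrix.add_mul]
      map_smul' := fun c A => by
        ext i a b; simp [evals] }

/-- The pairing `(Γ, X) ↦ ∑ i, ⟨Γ i, X i⟩`, as a map to the dual. -/
def pairing : (Fin n → symMat (Fin d)) →ₗ[ℝ] Module.Dual ℝ (Fin n → symMat (Fin d)) :=
  LinearMap.mk₂ ℝ (fun Γ X => ∑ i, frobInner (Γ i).1 (X i).1)
    (fun _ _ _ => by simp [frobInner_add_left, Finset.sum_add_distrib])
    (fun _ _ _ => by simp [frobInner_smul_left, Finset.mul_sum])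
    (fun _ _ _ => by simp [frobInner_add_right, Finset.sum_add_distrib])
    (fun _ _ _ => by simp [frobInner_smul_right, Finset.mul_sum])

lemma pairing_apply (Γ X : Fin n → symMat (Fin d)) :
    pairing Γ X = ∑ i, frobInner (Γ i).1 (X i).1 := rfl

/-- The pairing is definite, hence injective into a dual of equal dimension. This turns every
Hahn–Banach functional into some `Γ`. -/
lemma pairing_surjective : Function.Surjective (pairing (n := n) (d := d)) := by
  rw [← LinearMap.injective_iff_surjective_of_finrank_eq_finrank Subspace.dual_finrank_eq.symm]
  refine (injective_iff_map_eq_zero _).2 fun Γ hΓ => ?_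
  have h : ∑ i, frobSq (Γ i).1 = 0 := by
    simpa [pairing_apply, frobSq] using LinearMap.congr_fun hΓ Γ
  rw [Finset.sum_eq_zero_iff_of_nonneg fun i _ => frobSq_nonneg _] at h
  ext1 i
  exact Subtype.ext (eq_zero_of_frobSq_nonpos (h i (Finset.mem_univ i)).le)

/-- The Lagrange multiplier `X ↦ -∑ i, ⟨Γ i, X i⟩`. -/
def multiplier (Γ : Fin n → symMat (Fin d)) : (Fin n → symMat (Fin d)) →L[ℝ] ℝ :=
  LinearMap.toContinuousLinearMap (pairing (-Γ))

lemma multiplier_surjective : Function.Surjective (multiplier (n := n) (d := d)) := fun φ => by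
  obtain ⟨Γ, hΓ⟩ := pairing_surjective (φ : (Fin n → symMat (Fin d)) →ₗ[ℝ] ℝ)
  refine ⟨-Γ, ?_⟩
  ext X
  simp [multiplier, hΓ]

/-- By cyclicity of the trace, `Γ ↦ ∑ i, Ψ_i Γ_i Ψ_iᵀ` is the adjoint of the evaluations. -/
lemma frobInner_dualMat (lam₁ : ℝ) (Γ : Fin n → symMat (Fin d)) (B : symMat (Fin n × Fin d)) :
    frobInner (dualMat Ψ lam₁ Γ).1 B.1 = pairing Γ (evals Ψ B) + lam₁ * B.1.trace := by
  have hcyc : ∀ i, ((Ψ i * ((Γ i).1ᵀ * (Ψ i)ᵀ)) * B.1).trace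
      = ((Γ i).1ᵀ * ((Ψ i)ᵀ * B.1 * Ψ i)).trace := fun i => by
    rw [Matrix.mul_assoc, Matrix.trace_mul_comm]
    simp only [Matrix.mul_assoc]
  simp [pairing_apply, frobInner, dualMat, evals, Matrix.transpose_add, Matrix.transpose_sum,
    Matrix.transpose_mul, Matrix.add_mul, Matrix.sum_mul, Matrix.trace_sum, hcyc]

lemma pairing_add_regularizer (lam₁ lam₂ : ℝ) (Γ : Fin n → symMat (Fin d))
    (B : symMat (Fin n × Fin d)) :
    pairing Γ (evals Ψ B) + regularizer lam₁ lam₂ B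
      = frobInner (dualMat Ψ lam₁ Γ).1 B.1 + lam₂ / 2 * frobSq B.1 := by
  rw [frobInner_dualMat, regularizer]; ring

lemma continuous_regularizer (lam₁ lam₂ : ℝ) :
    Continuous (regularizer (n := n) (d := d) lam₁ lam₂) := by
  have h := (continuous_frobSq (m := Fin n × Fin d)).comp
    (continuous_subtype_val (p := (· ∈ symMat (Fin n × Fin d))))
  have ht : Continuous fun B : symMat (Fin n × Fin d) => B.1.trace := by fun_prop
  exact (ht.const_mul lam₁).add (h.const_mul (lam₂ / 2))

lemma convexOn_regularizer (lam₁ : ℝ) {lam₂ : ℝ} (h₂ : 0 ≤ lam₂) :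
    ConvexOn ℝ (psdCone (Fin n × Fin d)) (regularizer lam₁ lam₂) := by
  refine ⟨convex_psdCone, fun A _ B _ a b ha hb hab => ?_⟩
  obtain rfl : b = 1 - a := by linarith
  have h := frobSq_nonneg (A.1 - B.1)
  have hc := frobInner_comm B.1 A.1
  simp only [regularizer, frobSq, Submodule.coe_add, Submodule.coe_smul, Matrix.trace_add,
    Matrix.trace_smul, smul_eq_mul, frobInner_add_left, frobInner_add_right, frobInner_sub_left,
    frobInner_sub_right, frobInner_smul_left, frobInner_smul_right, hc] at h ⊢
  -- The convexity gap is exactly `λ₂ / 2 * a * b * ‖A - B‖²`.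
  have hk := mul_nonneg (mul_nonneg (mul_nonneg ha hb) h₂) h
  linarith

lemma regularizer_nonneg {lam₁ lam₂ : ℝ} (h₁ : 0 ≤ lam₁) (h₂ : 0 ≤ lam₂)
    {B : symMat (Fin n × Fin d)} (hB : B ∈ psdCone (Fin n × Fin d)) :
    0 ≤ regularizer lam₁ lam₂ B :=
  add_nonneg (mul_nonneg h₁ (Matrix.PosSemidef.trace_nonneg hB))
    (mul_nonneg (by linarith) (frobSq_nonneg _))

lemma isBounded_of_abs_apply_le {m : Type} [Fintype m] {S : Set (symMat m)} (ρ : ℝ)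
    (h : ∀ B ∈ S, ∀ i j, |B.1 i j| ≤ ρ) : Bornology.IsBounded S := by
  refine isBounded_iff_forall_norm_le.2 ⟨max ρ 0, fun B hB => ?_⟩
  exact (Matrix.norm_le_iff (le_max_right _ _)).2 fun i j => (h B hB i j).trans (le_max_left _ _)

lemma isBounded_regularizer_le {lam₁ lam₂ : ℝ} (h₁ : 0 ≤ lam₁) (h₂ : 0 ≤ lam₂)
    (h : 0 < lam₁ ∨ 0 < lam₂) (ρ : ℝ) :
    Bornology.IsBounded {B ∈ psdCone (Fin n × Fin d) | regularizer lam₁ lam₂ B ≤ ρ} := by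
  rcases h with h | h
  · refine isBounded_of_abs_apply_le (ρ / lam₁) fun B hB i j => ?_
    obtain ⟨hB, hBρ⟩ := hB
    refine (abs_apply_le_trace hB i j).trans ?_
    rw [le_div_iff₀ h, mul_comm]
    have := mul_nonneg (by linarith : 0 ≤ lam₂ / 2) (frobSq_nonneg B.1)
    rw [regularizer] at hBρ
    linarith
  · refine isBounded_of_abs_apply_le (√(2 * ρ / lam₂)) fun B hB i j => ?_
    obtain ⟨hB, hBρ⟩ := hB
    refine Real.abs_le_sqrt ((sq_apply_le_frobSq B.1 i j).trans ?_)
    rw [le_div_iff₀ h]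
    have := mul_nonneg h₁ (Matrix.PosSemidef.trace_nonneg hB)
    rw [regularizer] at hBρ
    linarith

variable {L : (Fin n → symMat (Fin d)) → EReal}

lemma fenchelConj_le_iff {c : ℝ} (hc : ∀ X, (c : EReal) ≤ L X) {Γ : Fin n → symMat (Fin d)}
    {t : ℝ} : fenchelConj L Γ ≤ (t : EReal) ↔
      ∀ X, ∀ s : ℝ, L X ≤ (s : EReal) → pairing Γ X - s ≤ t := by
  rw [fenchelConj, iSup_le_iff]
  refine forall_congr' fun X => ?_
  rw [← pairing_apply]
  have hX := hc X
  generalize L X = y at hX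
  induction y with
  | bot => simp at hX
  | top => simp
  | coe y =>
    rw [← EReal.coe_sub, EReal.coe_le_coe_iff]
    refine ⟨fun h s hs => ?_, fun h => h y le_rfl⟩
    have : y ≤ s := by exact_mod_cast hs
    linarith

lemma coe_le_neg_sub_coe_iff {x : EReal} {q r : ℝ} :
    (r : EReal) ≤ -x - (q : EReal) ↔ x ≤ ((-r - q : ℝ) : EReal) := by
  induction x with
  | bot => simp
  | top => simp [-EReal.coe_sub]
  | coe x =>
    rw [← EReal.coe_neg, ← EReal.coe_sub, EReal.coe_le_coe_iff, EReal.coe_le_coe_iff]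
    constructor <;> intro h <;> linarith

lemma isDualCertificate_multiplier_iff {lam₁ lam₂ : ℝ} {Γ : Fin n → symMat (Fin d)} {r : ℝ} :
    IsDualCertificate L (evalsCLM Ψ) (psdCone (Fin n × Fin d)) (regularizer lam₁ lam₂)
        (multiplier Γ) r ↔
      ∀ B ∈ psdCone (Fin n × Fin d), ∀ X, ∀ s : ℝ, L X ≤ (s : EReal) →
        r ≤ s - pairing Γ X + (pairing Γ (evals Ψ B) + regularizer lam₁ lam₂ B) := by
  refine forall₅_congr fun B hB X s hs => ?_
  change r ≤ s + pairing (-Γ) X - pairing (-Γ) (evals Ψ B) + _ ↔ _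
  rw [map_neg, LinearMap.neg_apply, LinearMap.neg_apply]
  constructor <;> intro h <;> linarith

lemma coe_le_dualObj_iff {c : ℝ} (hc : ∀ X, (c : EReal) ≤ L X) {lam₁ lam₂ : ℝ} (h₂ : 0 < lam₂)
    (Γ : Fin n → symMat (Fin d)) (r : ℝ) :
    (r : EReal) ≤ dualObj L Ψ lam₁ lam₂ Γ ↔
      IsDualCertificate L (evalsCLM Ψ) (psdCone (Fin n × Fin d)) (regularizer lam₁ lam₂)
        (multiplier Γ) r := by
  rw [dualObj, coe_le_neg_sub_coe_iff, fenchelConj_le_iff hc, isDualCertificate_multiplier_iff]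
  constructor
  · intro h B hB X s hs
    have h₁ := h X s hs
    have h₃ := le_frobInner_add_frobSq (dualMat Ψ lam₁ Γ) h₂ hB
    rw [← pairing_add_regularizer] at h₃
    have h₄ := mul_nonneg (by linarith : 0 ≤ lam₂ / 2)
      (frobSq_nonneg (B.1 - lam₂⁻¹ • (negPart (dualMat Ψ lam₁ Γ)).1))
    linarith
  · intro h X s hs
    -- Test the certificate at the exact minimizer over `B`.
    have h₁ := h _ (smul_negPart_mem_psdCone (dualMat Ψ lam₁ Γ) (inv_nonneg.2 h₂.le)) X s hs
    have h₃ := frobInner_add_frobSq_negPart (dualMat Ψ lam₁ Γ) h₂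
    rw [← pairing_add_regularizer] at h₃
    linarith

lemma coe_le_constrained_dualObj_iff {c : ℝ} (hc : ∀ X, (c : EReal) ≤ L X)
    (hdom : (effDom L).Nonempty) {lam₁ : ℝ} (Γ : Fin n → symMat (Fin d)) (r : ℝ) :
    (r : EReal) ≤ (⨆ _ : dualMat Ψ lam₁ Γ ∈ psdCone (Fin n × Fin d), -fenchelConj L Γ) ↔
      IsDualCertificate L (evalsCLM Ψ) (psdCone (Fin n × Fin d)) (regularizer lam₁ 0)
        (multiplier Γ) r := by
  have hreg : ∀ B, pairing Γ (evals Ψ B) + regularizer lam₁ 0 B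
      = frobInner (dualMat Ψ lam₁ Γ).1 B.1 := fun B => by
    rw [pairing_add_regularizer]; ring
  rw [isDualCertificate_multiplier_iff]
  by_cases hM : dualMat Ψ lam₁ Γ ∈ psdCone (Fin n × Fin d)
  · have e : (r : EReal) ≤ -fenchelConj L Γ ↔ fenchelConj L Γ ≤ ((-r : ℝ) : EReal) := by
      rw [EReal.le_neg, EReal.coe_neg]
    rw [iSup_pos hM, e, fenchelConj_le_iff hc]
    constructor
    · intro h B hB X s hs
      linarith [h X s hs, hreg B, frobInner_nonneg hM hB]
    · intro h X s hs
      have h₀ := h 0 Matrix.PosSemidef.zero X s hs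
      have h₁ := hreg 0
      rw [Submodule.coe_zero, show frobInner (dualMat Ψ lam₁ Γ).1 0 = 0 by simp [frobInner]] at h₁
      linarith
  -- An infeasible `Γ` has dual value `⊥`, so it must certify no real `r`.
  · rw [iSup_neg hM]
    simp only [le_bot_iff, EReal.coe_ne_bot, false_iff]
    intro h
    obtain ⟨B, hB, hneg⟩ := exists_frobInner_neg hM
    obtain ⟨X, hX⟩ := hdom
    obtain ⟨s, hs, -⟩ := EReal.lt_iff_exists_real_btwn.1 hX
    set b := frobInner (dualMat Ψ lam₁ Γ).1 B.1
    -- Moving this far along the ray of `B` pushes the Lagrangian below `r`.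
    set t := (|s - pairing Γ X - r| + 1) / (-b)
    have ht : 0 ≤ t := div_nonneg (by positivity) (by linarith)
    have h₀ := h (t • B) (Matrix.PosSemidef.smul hB ht) X s hs.le
    have h₁ := hreg (t • B)
    rw [Submodule.coe_smul, frobInner_smul_right] at h₁
    have h₃ : t * b = -(|s - pairing Γ X - r| + 1) := by
      have : b ≠ 0 := hneg.ne
      simp only [t]; field_simp
    linarith [le_abs_self (s - pairing Γ X - r)]

/-- Strong duality and dual attainment for a regularizer with a quadratic term. -/
lemma strong_duality_of_pos {c lam₁ lam₂ : ℝ} (hconv : IsConvexFun L) (hlsc : LowerSemicontinuous L)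
    (hc : ∀ X, (c : EReal) ≤ L X)
    (hfeas : ∃ B ∈ psdCone (Fin n × Fin d), evals Ψ B ∈ effDom L) (h₁ : 0 ≤ lam₁)
    (h₂ : 0 < lam₂) :
    (⨅ B ∈ psdCone (Fin n × Fin d), primalObj L Ψ lam₁ lam₂ B) = (⨆ Γ, dualObj L Ψ lam₁ lam₂ Γ) ∧
    ((∃ B ∈ psdCone (Fin n × Fin d), evals Ψ B ∈ interior (effDom L)) →
      ∃ Γ, IsMaxOn (dualObj L Ψ lam₁ lam₂) Set.univ Γ) :=
  fenchel_duality (A := evalsCLM Ψ) hconv hlsc hc isClosed_psdCone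
    (continuous_regularizer lam₁ lam₂) (convexOn_regularizer lam₁ h₂.le)
    (fun _ hB => regularizer_nonneg h₁ h₂.le hB)
    (isBounded_regularizer_le h₁ h₂.le (Or.inr h₂)) hfeas _ multiplier multiplier_surjective
    (coe_le_dualObj_iff hc h₂)

/-- Strong duality for the pure trace regularizer. -/
lemma strong_duality_trace {c lam₁ : ℝ} (hconv : IsConvexFun L) (hlsc : LowerSemicontinuous L)
    (hc : ∀ X, (c : EReal) ≤ L X)
    (hfeas : ∃ B ∈ psdCone (Fin n × Fin d), evals Ψ B ∈ effDom L) (h₁ : 0 < lam₁) :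
    (⨅ B ∈ psdCone (Fin n × Fin d), primalObj L Ψ lam₁ 0 B)
      = ⨆ Γ, ⨆ _ : dualMat Ψ lam₁ Γ ∈ psdCone (Fin n × Fin d), -fenchelConj L Γ :=
  (fenchel_duality (A := evalsCLM Ψ) hconv hlsc hc isClosed_psdCone
    (continuous_regularizer lam₁ 0) (convexOn_regularizer lam₁ le_rfl)
    (fun _ hB => regularizer_nonneg h₁.le le_rfl hB)
    (isBounded_regularizer_le h₁.le le_rfl (Or.inl h₁)) hfeas _ multiplier multiplier_surjective
    (coe_le_constrained_dualObj_iff hc (let ⟨_, _, h⟩ := hfeas; ⟨_, h⟩))).1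

/-- A dual solution yields the primal solution `λ₂⁻¹ [∑ i, Ψ_i Γ_i Ψ_iᵀ + λ₁ I]₋`. -/
lemma isMinOn_of_isMaxOn {c lam₁ lam₂ : ℝ} (hconv : IsConvexFun L) (hlsc : LowerSemicontinuous L)
    (hc : ∀ X, (c : EReal) ≤ L X)
    (hfeas : ∃ B ∈ psdCone (Fin n × Fin d), evals Ψ B ∈ effDom L) (h₁ : 0 ≤ lam₁)
    (h₂ : 0 < lam₂) {Γ : Fin n → symMat (Fin d)}
    (hΓ : IsMaxOn (dualObj L Ψ lam₁ lam₂) Set.univ Γ) :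
    IsMinOn (primalObj L Ψ lam₁ lam₂) (psdCone (Fin n × Fin d))
      (lam₂⁻¹ • negPart (dualMat Ψ lam₁ Γ)) := by
  obtain ⟨v, hv, B, hB, hBv⟩ := exists_primal_solution (A := evalsCLM Ψ) hlsc hc isClosed_psdCone
    (continuous_regularizer lam₁ lam₂) (fun _ hB => regularizer_nonneg h₁ h₂.le hB)
    (isBounded_regularizer_le h₁ h₂.le (Or.inr h₂)) hfeas
  change (⨅ B ∈ psdCone (Fin n × Fin d), primalObj L Ψ lam₁ lam₂ B) = v at hv
  change primalObj L Ψ lam₁ lam₂ B ≤ v at hBv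
  have hD : (v : EReal) ≤ dualObj L Ψ lam₁ lam₂ Γ := by
    rw [← hv, (strong_duality_of_pos hconv hlsc hc hfeas h₁ h₂).1]
    exact iSup_le fun Γ' => hΓ (Set.mem_univ Γ')
  rw [dualObj, coe_le_neg_sub_coe_iff, fenchelConj_le_iff hc] at hD
  have h := hD _ _ (add_coe_le_coe_iff.1 hBv)
  have h₃ := le_frobInner_add_frobSq (dualMat Ψ lam₁ Γ) h₂ hB
  rw [← pairing_add_regularizer] at h₃
  -- With no duality gap, the quadratic slack at the existing primal minimizer `B` has no room, so
  -- `B` is the claimed matrix.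
  have h₄ : frobSq (B.1 - lam₂⁻¹ • (negPart (dualMat Ψ lam₁ Γ)).1) ≤ 0 := by
    refine nonpos_of_mul_nonpos_right (a := lam₂ / 2) ?_ (by linarith)
    linarith
  have hBeq : lam₂⁻¹ • negPart (dualMat Ψ lam₁ Γ) = B :=
    Subtype.ext (sub_eq_zero.1 (eq_zero_of_frobSq_nonpos h₄)).symm
  rw [hBeq]
  exact fun B' hB' => hBv.trans (hv ▸ iInf₂_le B' hB')

end Problem

end PSDLearning

end

open PSDLearning in
theorem mainTheorem3 {X : Type*} (n d : ℕ)
    -- a positive definite kernel, sample points, and the features built from them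
    (k : X → X → ℝ) (hk : (Matrix.of k).PosSemidef) (x : Fin n → X)
    (R : Matrix (Fin n) (Fin n) ℝ) (hR : IsUpperCholesky R (kernelMatrix k x))
    (L : (Fin n → symMat (Fin d)) → EReal)
    (hconv : IsConvexFun L) (hlsc : LowerSemicontinuous L)
    (hbdd : ∃ c : ℝ, ∀ Y, (c : EReal) ≤ L Y)
    (hfeas : ∃ B ∈ psdCone (Fin n × Fin d), evals (features d R) B ∈ effDom L)
    (lam₁ lam₂ : ℝ) :
    (0 < lam₂ → 0 ≤ lam₁ →
      (⨅ B ∈ psdCone (Fin n × Fin d), primalObj L (features d R) lam₁ lam₂ B)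
          = (⨆ Γ, dualObj L (features d R) lam₁ lam₂ Γ)
      -- attainment; the qualification always holds when `L` is finite everywhere
      ∧ ((∃ B ∈ psdCone (Fin n × Fin d), evals (features d R) B ∈ interior (effDom L)) →
          ∃ Γ, IsMaxOn (dualObj L (features d R) lam₁ lam₂) Set.univ Γ)
      ∧ ∀ Γ, IsMaxOn (dualObj L (features d R) lam₁ lam₂) Set.univ Γ →
          lam₂⁻¹ • negPart (dualMat (features d R) lam₁ Γ) ∈ psdCone (Fin n × Fin d)
          ∧ IsMinOn (primalObj L (features d R) lam₁ lam₂) (psdCone (Fin n × Fin d))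
              (lam₂⁻¹ • negPart (dualMat (features d R) lam₁ Γ)))
    ∧ (lam₂ = 0 → 0 < lam₁ →
      (⨅ B ∈ psdCone (Fin n × Fin d), primalObj L (features d R) lam₁ lam₂ B)
        = (⨆ Γ ∈ {Γ : Fin n → symMat (Fin d) |
            dualMat (features d R) lam₁ Γ ∈ psdCone (Fin n × Fin d)}, -fenchelConj L Γ)) := by
  obtain ⟨c, hc⟩ := hbdd
  refine ⟨fun h₂ h₁ => ?_, ?_⟩
  · obtain ⟨hval, hatt⟩ := strong_duality_of_pos (Ψ := features d R) hconv hlsc hc hfeas h₁ h₂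
    exact ⟨hval, hatt, fun Γ hΓ => ⟨smul_negPart_mem_psdCone _ (inv_nonneg.2 h₂.le),
      isMinOn_of_isMaxOn hconv hlsc hc hfeas h₁ h₂ hΓ⟩⟩
  · rintro rfl h₁
    exact strong_duality_trace hconv hlsc hc hfeas h₁
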